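/- Let $(Y,\Omega)$ be a closed connected symplectic manifold with its Liouville measure, and let $G$ be the group of its Hamiltonian diffeomorphisms (the symplectomorphisms which can be included into a smooth time-dependent Hamiltonian flow), with the $C^\infty$-topology. A smooth loop in $G$ is a map $h:S^1=\mathbb R/\mathbb Z\to G$ such that $h(t)y$ is smooth in $(t,y)$ and $h$ is generated by a smooth Hamiltonian function $H:S^1\times Y\to\mathbb R$, normalized by $\int_Y H(t,\cdot)=0$ for all $t$; thus $H$ is a smooth loop in the Lie algebra $C^\infty_0(Y)$ of smooth functions with zero mean. Its length is $\int_0^1\max_{y\in Y}|H(t,y)|\,dt$. For $\gamma\in\pi_1(G)$ let $\|\gamma\|$ be the infimum of the lengths of the smooth loops representing $\gamma$, and let $\|\gamma\|_\infty=\lim_{k\to\infty}\frac1k\|\gamma^k\|$ be the asymptotic Hofer norm. Let $\alpha_1,\alpha_2,\dots$ be arbitrary real numbers, let $g_1,g_2,\dots\in G$ be arbitrary, and let $h:S^1\to G$ be a smooth loop representing $\gamma\in\pi_1(G)$. Consider the skew products $T_i(t,y)=(t+\alpha_i,\;g_i\,h(t)\,y)$ on $X=S^1\times Y$, where $X$ carries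 the product of Lebesgue measure and the Liouville measure, and put $T^{(0)}=\mathrm{id}$ and $T^{(n)}=T_n\circ\dots\circ T_1$. Suppose that the sequence $(T_i)$ is strictly ergodic: for every continuous function $F:X\to\mathbb R$ with zero mean, the time averages $\frac1N\sum_{i=0}^{N-1}F\circ T^{(i)}$ converge to zero uniformly on $X$ as $N\to\infty$. Then the limit defining $\|\gamma\|_\infty$ exists and $\|\gamma\|_\infty=0$. -/

import Mathlib

open MeasureTheory Filter
open scoped Manifold ContDiff Topology ENNReal

/-! ### Symplectic manifolds and the Liouville measure -/

section Symplectic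

variable {n : ℕ} {Y : Type*} [TopologicalSpace Y] [ChartedSpace (EuclideanSpace ℝ (Fin n)) Y]

/-- The expression in the preferred chart at `x` of a field of alternating 2-forms on `Y`, i.e. its
pullback under the inverse of the chart. It is meaningful on the target of the chart. -/
noncomputable def formInChart
    (Ω : ∀ y : Y, TangentSpace (𝓡 n) y [⋀^Fin 2]→L[ℝ] ℝ) (x : Y)
    (u : EuclideanSpace ℝ (Fin n)) : EuclideanSpace ℝ (Fin n) [⋀^Fin 2]→L[ℝ] ℝ :=
  (Ω ((extChartAt (𝓡 n) x).symm u)).compContinuousLinearMap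
    (mfderiv 𝓘(ℝ, EuclideanSpace ℝ (Fin n)) (𝓡 n) (extChartAt (𝓡 n) x).symm u)

variable (n Y) in
/-- A symplectic form: a smooth closed nondegenerate differential 2-form on the manifold `Y`. -/
structure SymplecticForm where
  form : ∀ y : Y, TangentSpace (𝓡 n) y [⋀^Fin 2]→L[ℝ] ℝ
  smooth : ∀ x : Y, ContDiffOn ℝ ∞ (formInChart form x) (extChartAt (𝓡 n) x).target
  closed : ∀ x : Y, ∀ u ∈ (extChartAt (𝓡 n) x).target, extDeriv (formInChart form x) u = 0
  nondegenerate : ∀ (y : Y) (v : TangentSpace (𝓡 n) y), (∀ w, form y ![v, w] = 0) → v = 0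

/-- The density `√(det Ω(∂ᵢ, ∂ⱼ))` of the volume form `Ω ^ m / m!` (where `n = 2 m`) with respect
to Lebesgue measure, in the preferred chart at `x`. -/
noncomputable def liouvilleDensity (Ω : SymplecticForm n Y) (x : Y)
    (u : EuclideanSpace ℝ (Fin n)) : ℝ :=
  √(Matrix.of fun i j : Fin n => formInChart Ω.form x u
    ![EuclideanSpace.single i (1 : ℝ), EuclideanSpace.single j (1 : ℝ)]).det

/-- The Liouville measure restricted to the domain of the preferred chart at `x`, seen as a measure
on `Y`: Lebesgue measure times the density above, transported by the inverse of the chart. -/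
noncomputable def liouvilleInChart [MeasurableSpace Y] (Ω : SymplecticForm n Y) (x : Y) :
    Measure Y :=
  Measure.map (extChartAt (𝓡 n) x).symm
    ((volume.restrict (extChartAt (𝓡 n) x).target).withDensity
      fun u => ENNReal.ofReal (liouvilleDensity Ω x u))

/-- The Liouville measure of a symplectic manifold. The measures in the charts are the restrictions
of one measure to the chart domains, which is therefore their least upper bound. -/
noncomputable def liouville [MeasurableSpace Y] (Ω : SymplecticForm n Y) : Measure Y :=
  ⨆ x : Y, liouvilleInChart Ω x

/-! ### Hamiltonian diffeomorphisms -/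

/-- The family of maps `φ t` is generated by the time-dependent Hamiltonian `H`: its velocity is
`∂φ/∂t (t, y) = X (t, φ t y)`, where `X (t, ·)` is the Hamiltonian vector field of `H t`,
that is `Ω (X (t, ·), ·) = - d (H t)`. -/
def GeneratedBy (Ω : SymplecticForm n Y) (φ : ℝ → Y → Y) (H : ℝ → Y → ℝ) : Prop :=
  ∀ (t : ℝ) (y : Y) (w : TangentSpace (𝓡 n) (φ t y)),
    Ω.form (φ t y) ![mfderiv 𝓘(ℝ, ℝ) (𝓡 n) (fun s => φ s y) t (1 : ℝ), w] =
      - mfderiv (𝓡 n) 𝓘(ℝ, ℝ) (H t) (φ t y) w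

/-- The diffeomorphism `g` preserves `Ω`. -/
def IsSymplectomorphism (Ω : SymplecticForm n Y) (g : Y ≃ₘ⟮𝓡 n, 𝓡 n⟯ Y) : Prop :=
  ∀ y : Y, (Ω.form (g y)).compContinuousLinearMap (mfderiv (𝓡 n) (𝓡 n) g y) = Ω.form y

/-- `φ` is the flow of the smooth time-dependent Hamiltonian `H`, starting at the identity. -/
structure IsHamiltonianFlow (Ω : SymplecticForm n Y) (φ : ℝ → Y ≃ₘ⟮𝓡 n, 𝓡 n⟯ Y)
    (H : ℝ → Y → ℝ) : Prop where
  smooth_hamiltonian : ContMDiff (𝓘(ℝ, ℝ).prod (𝓡 n)) 𝓘(ℝ, ℝ) ∞ fun p : ℝ × Y => H p.1 p.2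
  smooth : ContMDiff (𝓘(ℝ, ℝ).prod (𝓡 n)) (𝓡 n) ∞ fun p : ℝ × Y => φ p.1 p.2
  symplectic : ∀ t, IsSymplectomorphism Ω (φ t)
  zero : ∀ y, φ 0 y = y
  generated : GeneratedBy Ω (fun t => φ t) H

/-- The group `G` of Hamiltonian diffeomorphisms: the symplectomorphisms which can be included into
a time-dependent Hamiltonian flow, as its time-one map. -/
def HamDiffeo (Ω : SymplecticForm n Y) : Type _ :=
  {g : Y ≃ₘ⟮𝓡 n, 𝓡 n⟯ Y // IsSymplectomorphism Ω g ∧ ∃ φ H, IsHamiltonianFlow Ω φ H ∧ φ 1 = g}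

noncomputable instance HamDiffeo.instCoeFun (Ω : SymplecticForm n Y) : CoeFun (HamDiffeo Ω) fun _ => Y → Y :=
  ⟨fun g => ⇑g.1⟩

theorem isSymplectomorphism_refl (Ω : SymplecticForm n Y) :
    IsSymplectomorphism Ω (Diffeomorph.refl (𝓡 n) Y ∞) := by
  intro y
  rw [Diffeomorph.coe_refl, mfderiv_id]
  rfl

theorem isHamiltonianFlow_refl (Ω : SymplecticForm n Y) :
    IsHamiltonianFlow Ω (fun _ => Diffeomorph.refl (𝓡 n) Y ∞) fun _ _ => 0 where
  smooth_hamiltonian := contMDiff_const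
  smooth := contMDiff_snd
  symplectic _ := isSymplectomorphism_refl Ω
  zero _ := rfl
  generated t y w := by
    have h0 : mfderiv 𝓘(ℝ, ℝ) (𝓡 n) (fun _ : ℝ => y) t (1 : ℝ) = 0 := by
      rw [mfderiv_const]; rfl
    have h1 : mfderiv (𝓡 n) 𝓘(ℝ, ℝ) (fun _ : Y => (0 : ℝ)) y w = 0 := by
      rw [mfderiv_const]; rfl
    have h2 : Ω.form y ![0, w] = 0 := (Ω.form y).map_coord_zero 0 rfl
    exact ((congrArg (fun v => Ω.form y ![v, w]) h0).trans h2).trans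
      ((neg_eq_zero.2 h1).symm)

/-- The identity, as a Hamiltonian diffeomorphism. -/
noncomputable def HamDiffeo.id (Ω : SymplecticForm n Y) : HamDiffeo Ω :=
  ⟨Diffeomorph.refl (𝓡 n) Y ∞, isSymplectomorphism_refl Ω, _, _, isHamiltonianFlow_refl Ω, rfl⟩

end Symplectic

/-! ### The smooth topology and the fundamental group -/

section Topology

/-- The compact-open `C^k` topology on the self-maps of a manifold `M`, which is used for smooth
maps only. For `k = 0` it is the compact-open topology; the `C^(k+1)` topology is the coarsest one
for which the passage `f ↦ T f` to the tangent map `T f : T M → T M` is continuous into the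
`C^k` topology. Thus it is induced by the compact-open topology through `f ↦ T^k f`. -/
@[reducible]
noncomputable def ckTopology : (k : ℕ) → {E : Type} → [NormedAddCommGroup E] → [NormedSpace ℝ E] →
    {H : Type} → [TopologicalSpace H] → (I : ModelWithCorners ℝ E H) →
    (M : Type*) → [TopologicalSpace M] → [ChartedSpace H M] → [IsManifold I ∞ M] →
    TopologicalSpace (M → M)
  | 0, _, _, _, _, _, _, M, _, _, _ =>
      TopologicalSpace.generateFrom
        {S | ∃ K U : Set M, IsCompact K ∧ IsOpen U ∧ S = {f | Set.MapsTo f K U}}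
  | k + 1, _, _, _, _, _, I, M, _, _, _ =>
      TopologicalSpace.induced (fun f => tangentMap I I f)
        (haveI : IsManifold I.tangent ∞ (TangentBundle I M) :=
            Bundle.TotalSpace.isManifold (n := ∞) _ _
         ckTopology k I.tangent (TangentBundle I M))

variable {n : ℕ} {Y : Type*} [TopologicalSpace Y] [ChartedSpace (EuclideanSpace ℝ (Fin n)) Y]
  [IsManifold (𝓡 n) ∞ Y]

/-- The `C^∞` topology on the group of Hamiltonian diffeomorphisms: the coarsest topology which is
finer than all the `C^k` topologies. -/
noncomputable instance HamDiffeo.instTopologicalSpace (Ω : SymplecticForm n Y) :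
    TopologicalSpace (HamDiffeo Ω) :=
  TopologicalSpace.induced (fun g => (g : Y → Y)) (⨅ k : ℕ, ckTopology k (𝓡 n) Y)

/-- The loop `h` (not necessarily based at the identity) represents the class `γ ∈ π₁(G)`: it is
freely homotopic, through loops in `G`, to a loop based at the identity whose class is `γ`. -/
def Represents {Ω : SymplecticForm n Y} (h : UnitAddCircle → HamDiffeo Ω)
    (γ : FundamentalGroup (HamDiffeo Ω) (HamDiffeo.id Ω)) : Prop :=
  ∃ p : Path (HamDiffeo.id Ω) (HamDiffeo.id Ω),
    FundamentalGroup.fromPath (Path.Homotopic.Quotient.mk p) = γ ∧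
    ∃ F : C(unitInterval × UnitAddCircle, HamDiffeo Ω),
      (∀ t, F (0, t) = h t) ∧ ∀ t : unitInterval, F (1, ((t : ℝ) : UnitAddCircle)) = p t

end Topology

/-! ### Hofer's length and norm -/

section Hofer

variable {n : ℕ} {Y : Type*} [TopologicalSpace Y] [ChartedSpace (EuclideanSpace ℝ (Fin n)) Y]
  [MeasurableSpace Y] {Ω : SymplecticForm n Y}

/-- `H : S¹ × Y → ℝ` is the smooth normalized Hamiltonian function generating the loop `h`.
Smoothness on `S¹ × Y` is that of the lift to `ℝ × Y`. -/
structure IsNormalizedHamiltonian (h : UnitAddCircle → HamDiffeo Ω) (H : UnitAddCircle → Y → ℝ) :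
    Prop where
  smooth : ContMDiff (𝓘(ℝ, ℝ).prod (𝓡 n)) 𝓘(ℝ, ℝ) ∞ fun p : ℝ × Y => H (p.1 : UnitAddCircle) p.2
  generated : GeneratedBy Ω (fun t => h (t : UnitAddCircle)) fun t => H (t : UnitAddCircle)
  normalized : ∀ t, ∫ y, H t y ∂(liouville Ω) = 0

/-- A smooth loop `h : S¹ → G`, where `G` is regarded as an infinite-dimensional Lie group whose Lie
algebra is the space of smooth functions on `Y` with zero mean: `h t y` is smooth in `(t, y)` and
the velocity of `h` is a smooth loop `t ↦ H t` in the Lie algebra. -/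
structure IsSmoothLoop (h : UnitAddCircle → HamDiffeo Ω) : Prop where
  smooth : ContMDiff (𝓘(ℝ, ℝ).prod (𝓡 n)) (𝓡 n) ∞ fun p : ℝ × Y => h (p.1 : UnitAddCircle) p.2
  velocity : ∃ H, IsNormalizedHamiltonian h H

/-- Hofer's length `∫₀¹ max_y |H(t, y)| dt` of the loop generated by the normalized
Hamiltonian `H`. -/
noncomputable def hoferLength (H : UnitAddCircle → Y → ℝ) : ℝ≥0∞ :=
  ∫⁻ t : UnitAddCircle, ⨆ y : Y, ‖H t y‖ₑ

/-- Hofer's norm `‖γ‖` of `γ ∈ π₁(G)`: the infimum of the lengths of the smooth loops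
representing `γ`. -/
noncomputable def hoferNorm [IsManifold (𝓡 n) ∞ Y]
    (γ : FundamentalGroup (HamDiffeo Ω) (HamDiffeo.id Ω)) : ℝ≥0∞ :=
  ⨅ (h : UnitAddCircle → HamDiffeo Ω) (H : UnitAddCircle → Y → ℝ) (_ : IsSmoothLoop h)
    (_ : IsNormalizedHamiltonian h H) (_ : Represents h γ), hoferLength H

/-- The asymptotic Hofer norm `lim ‖γ ^ k‖ / k` of `γ ∈ π₁(G)` exists and is equal to `c`. -/
def HasAsymptoticHoferNorm [IsManifold (𝓡 n) ∞ Y]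
    (γ : FundamentalGroup (HamDiffeo Ω) (HamDiffeo.id Ω)) (c : ℝ≥0∞) : Prop :=
  Tendsto (fun k : ℕ => hoferNorm (γ ^ k) / (k : ℝ≥0∞)) atTop (𝓝 c)

end Hofer

/-! ### Sequential systems -/

section Sequential

variable {X : Type*}

/-- The evolution `T^(k) = T_k ∘ ... ∘ T_1` of a sequence of maps; here `T i` stands
for `T_(i+1)`. -/
def evolution (T : ℕ → X → X) : ℕ → X → X
  | 0 => id
  | k + 1 => T k ∘ evolution T k

/-- The sequence `T` is strictly ergodic with respect to `μ`: for every continuous function with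
zero mean the time averages `(1/N) ∑_{i < N} F ∘ T^(i)` converge uniformly to zero. -/
def StrictlyErgodicSeq [TopologicalSpace X] [MeasurableSpace X] (μ : Measure X)
    (T : ℕ → X → X) : Prop :=
  ∀ F : C(X, ℝ), ∫ x, F x ∂μ = 0 →
    TendstoUniformly (fun (N : ℕ) (x : X) => (1 / (N : ℝ)) * ∑ i ∈ Finset.range N,
      F (evolution T i x)) (fun _ => 0) atTop

end Sequential

/-- The skew product `(t, y) ↦ (t + α, g (h t y))` on `S¹ × Y`. -/
noncomputable def skewProduct {Y : Type*} (α : ℝ) (g : Y → Y) (h : UnitAddCircle → Y → Y) :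
    UnitAddCircle × Y → UnitAddCircle × Y :=
  fun x => (x.1 + (α : UnitAddCircle), g (h x.1 x.2))

/-!
The maps `T^(N)` of the sequential system have the form `(t, y) ↦ (t + β_N, f_N(t) y)`, where
`β_k = α_1 + ⋯ + α_k` and `f_N` is the loop
`f_N(t) = g_N h(t + β_(N-1)) ⋯ g_2 h(t + β_1) g_1 h(t)` in `G` (`fibreLoop`,
`evolution_skewProduct`).

The loop `f_N` represents `γ ^ N` (`represents_fibreLoop`): the constant loops `g_i` are freely
homotopic to the identity, as `G` is connected by paths (`HamDiffeo.joined_one`), rotations of the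
circle are homotopic to the identity, and in a topological monoid the pointwise product of loops is
homotopic to their concatenation (`Path.homotopic_mul_trans`). That composition is continuous in
the `C^∞` topology follows by applying the tangent functor until the topology is the compact-open
one (`continuous_ckTopology_comp`).

If `a` and `b` are loops with Hamiltonians `A` and `B`, then their product has the Hamiltonian
`A(t, y) + B(t, a(t)⁻¹ y)` (`GeneratedBy.trans`). It is smooth by the inverse function theorem
(`contMDiff_symm_family`), and it has zero mean because symplectomorphisms preserve the Liouville
measure (`IsSymplectomorphism.measurePreserving`). Iterating, the Hamiltonian `F_N` of `f_N`
satisfies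
`F_N(t, f_N(t) y) = ∑_{i < N} F(T^(i)(t, y))` with `F(t, y) = H(t, h(t) y)`
(`exists_normalizedHamiltonian_fibreLoop`). The function `F` is continuous with zero mean, so strict
ergodicity says that `max |F_N| / N` tends to zero, uniformly in `t`. As `‖γ ^ N‖` is at most
`∫ max_y |F_N(t, y)| dt` (`hoferNorm_pow_le`), the quotient `‖γ ^ N‖ / N` tends to zero.
-/

/-! ### Continuity in the `C^k` topologies -/

section CkTopology

/-- For continuous maps, the `C^0` topology is the compact-open topology. -/
theorem continuous_ckTopology_zero_iff {E H : Type} [NormedAddCommGroup E] [NormedSpace ℝ E]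
    [TopologicalSpace H] (I : ModelWithCorners ℝ E H) {M Z : Type*} [TopologicalSpace M]
    [ChartedSpace H M] [IsManifold I ∞ M] [TopologicalSpace Z] {f : Z → M → M}
    (hf : ∀ z, Continuous (f z)) :
    Continuous[inferInstance, ckTopology 0 I M] f ↔
      Continuous (fun z => (⟨f z, hf z⟩ : C(M, M))) := by
  rw [ContinuousMap.continuous_compactOpen]
  constructor
  · intro h K hK U hU
    exact continuous_generateFrom_iff.1 h _ ⟨K, U, hK, hU, rfl⟩
  · intro h
    refine continuous_generateFrom_iff.2 ?_
    rintro _ ⟨K, U, hK, hU, rfl⟩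
    exact h K hK U hU

/-- Composition is continuous in the `C^k` topology: the tangent functor reduces this to the
compact-open topology on the self-maps of an iterated tangent bundle, which is locally compact. -/
theorem continuous_ckTopology_comp (k : ℕ) : ∀ {E H : Type} [NormedAddCommGroup E]
    [NormedSpace ℝ E] [FiniteDimensional ℝ E] [TopologicalSpace H] (I : ModelWithCorners ℝ E H)
    {M Z : Type*} [TopologicalSpace M] [ChartedSpace H M] [IsManifold I ∞ M] [TopologicalSpace Z]
    {f g : Z → M → M} (_ : ∀ z, ContMDiff I I ∞ (f z)) (_ : ∀ z, ContMDiff I I ∞ (g z))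
    (_ : Continuous[inferInstance, ckTopology k I M] f)
    (_ : Continuous[inferInstance, ckTopology k I M] g),
    Continuous[inferInstance, ckTopology k I M] fun z => f z ∘ g z := by
  induction k with
  | zero =>
    intro E H _ _ _ _ I M Z _ _ _ _ f g hf hg cf cg
    have : LocallyCompactSpace M := Manifold.locallyCompact_of_finiteDimensional I
    rw [continuous_ckTopology_zero_iff I fun z => (hf z).continuous] at cf
    rw [continuous_ckTopology_zero_iff I fun z => (hg z).continuous] at cg
    rw [continuous_ckTopology_zero_iff I fun z => (hf z).continuous.comp (hg z).continuous]
    exact cf.compCM cg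
  | succ k ih =>
    intro E H _ _ _ _ I M Z _ _ _ _ f g hf hg cf cg
    have : IsManifold I.tangent ∞ (TangentBundle I M) :=
      Bundle.TotalSpace.isManifold (n := ∞) _ _
    have hf' : ∀ z, ContMDiff I.tangent I.tangent ∞ (tangentMap I I (f z)) := fun z =>
      (hf z).contMDiff_tangentMap (by simp)
    have hg' : ∀ z, ContMDiff I.tangent I.tangent ∞ (tangentMap I I (g z)) := fun z =>
      (hg z).contMDiff_tangentMap (by simp)
    have key := ih I.tangent hf' hg' (continuous_induced_rng.1 cf) (continuous_induced_rng.1 cg)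
    refine continuous_induced_rng.2 ?_
    convert key using 1
    funext z
    exact tangentMap_comp ((hf z).mdifferentiable (by simp)) ((hg z).mdifferentiable (by simp))

/-- A family of maps which is jointly smooth is continuous in the `C^k` topology: the family of the
tangent maps is again jointly smooth. -/
theorem continuous_ckTopology_of_contMDiff (k : ℕ) : ∀ {E H : Type} [NormedAddCommGroup E]
    [NormedSpace ℝ E] [TopologicalSpace H] (I : ModelWithCorners ℝ E H)
    {M : Type*} [TopologicalSpace M] [ChartedSpace H M] [IsManifold I ∞ M]
    {f : ℝ → M → M}
    (_ : ContMDiff (𝓘(ℝ, ℝ).prod I) I ∞ fun p : ℝ × M => f p.1 p.2),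
    Continuous[inferInstance, ckTopology k I M] f := by
  induction k with
  | zero =>
    intro E H _ _ _ I M _ _ _ f hf
    have hc : ∀ t, Continuous (f t) := fun t =>
      hf.continuous.comp (Continuous.prodMk_right t)
    rw [continuous_ckTopology_zero_iff I hc]
    exact (ContinuousMap.curry ⟨fun p : ℝ × M => f p.1 p.2, hf.continuous⟩).continuous
  | succ k ih =>
    intro E H _ _ _ I M _ _ _ f hf
    have : IsManifold I.tangent ∞ (TangentBundle I M) :=
      Bundle.TotalSpace.isManifold (n := ∞) _ _
    refine continuous_induced_rng.2 (ih I.tangent ?_)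
    -- the partial tangent map is the tangent map of the family, evaluated on vectors `(0, v)`
    have h0 : ContMDiff 𝓘(ℝ, ℝ) 𝓘(ℝ, ℝ).tangent ∞
        (fun t : ℝ => (⟨t, 0⟩ : TangentBundle 𝓘(ℝ, ℝ) ℝ)) :=
      Bundle.contMDiff_zeroSection ℝ (TangentSpace 𝓘(ℝ, ℝ) : ℝ → Type)
    have h1 : ContMDiff (𝓘(ℝ, ℝ).prod I.tangent) (𝓘(ℝ, ℝ).prod I).tangent ∞
        (fun p : ℝ × TangentBundle I M => (equivTangentBundleProd 𝓘(ℝ, ℝ) ℝ I M).symm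
          ((⟨p.1, 0⟩ : TangentBundle 𝓘(ℝ, ℝ) ℝ), p.2)) :=
      contMDiff_equivTangentBundleProd_symm.comp
        ((h0.comp contMDiff_fst).prodMk contMDiff_snd)
    have h2 := (hf.contMDiff_tangentMap (m := ∞) (by simp)).comp h1
    convert h2 using 1
    funext p
    obtain ⟨t, y, v⟩ := p
    have hd : MDifferentiableAt (𝓘(ℝ, ℝ).prod I) I (fun p : ℝ × M => f p.1 p.2) (t, y) :=
      hf.mdifferentiable (by simp) _
    have := mfderiv_prod_eq_add_apply (v := ((0, v) : ℝ × E)) hd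
    simp only [tangentMap, Function.comp, equivTangentBundleProd]
    congr 1
    refine Eq.trans ?_ this.symm
    refine Eq.trans ?_ (congrArg (· + _) (ContinuousLinearMap.map_zero _).symm)
    exact (zero_add _).symm

end CkTopology

/-! ### The inverse function theorem for families of diffeomorphisms -/

section InverseFunction

/-- The inverse function theorem on manifolds, in the form of a smooth local right inverse. -/
theorem exists_contMDiffAt_local_rightInverse {E H M N : Type*} [NormedAddCommGroup E]
    [NormedSpace ℝ E] [FiniteDimensional ℝ E] [TopologicalSpace H] {I : ModelWithCorners ℝ E H}
    [I.Boundaryless] [TopologicalSpace M] [ChartedSpace H M] [IsManifold I ∞ M]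
    [TopologicalSpace N] [ChartedSpace H N] [IsManifold I ∞ N] {f : M → N} {x : M}
    (hf : ContMDiffAt I I ∞ f x) (hinj : ∀ v : TangentSpace I x, mfderiv I I f x v = 0 → v = 0) :
    ∃ g : N → M, ContMDiffAt I I ∞ g (f x) ∧ g (f x) = x ∧ ∀ᶠ z in 𝓝 (f x), f (g z) = z := by
  have : CompleteSpace E := FiniteDimensional.complete ℝ E
  set F := writtenInExtChartAt I I x f with hF
  set a := extChartAt I x x with ha
  have hc : ContDiffAt ℝ ∞ F a := by
    have := (contMDiffAt_iff.1 hf).2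
    rwa [I.range_eq_univ, contDiffWithinAt_univ] at this
  have hd : mfderiv I I f x = fderiv ℝ F a := by
    rw [(hf.mdifferentiableAt (by simp)).mfderiv, I.range_eq_univ, fderivWithin_univ]
  let e₀ : E ≃ₗ[ℝ] E := LinearEquiv.ofInjectiveEndo (fderiv ℝ F a).toLinearMap (by
    refine (injective_iff_map_eq_zero _).2 fun v hv => hinj v ?_
    rw [hd]; exact hv)
  let e : E ≃L[ℝ] E := e₀.toContinuousLinearEquiv
  have he : HasFDerivAt F (e : E →L[ℝ] E) a := by
    have : (e : E →L[ℝ] E) = fderiv ℝ F a := by ext v; rfl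
    rw [this]
    exact (hc.differentiableAt (by simp)).hasFDerivAt
  let L : E → E := hc.localInverse he (by simp)
  have hFa : F a = extChartAt I (f x) (f x) := by simp [hF, ha, writtenInExtChartAt]
  have hLa : L (F a) = a := hc.localInverse_apply_image he (by simp)
  have hLc : ContDiffAt ℝ ∞ L (F a) := hc.to_localInverse he (by simp)
  have hFL : ∀ᶠ u in 𝓝 (F a), F (L u) = u :=
    (hc.hasStrictFDerivAt' he (by simp)).eventually_right_inverse
  rw [hFa] at hLa hLc hFL
  set g : N → M := fun z => (extChartAt I x).symm (L (extChartAt I (f x) z)) with hg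
  have hgx : g (f x) = x := by
    rw [hg]; dsimp only; rw [hLa, ha, extChartAt_to_inv]
  have hgc : ContMDiffAt I I ∞ g (f x) := by
    have s1 : ContMDiffAt I 𝓘(ℝ, E) ∞ (extChartAt I (f x)) (f x) := contMDiffAt_extChartAt
    have s2 : ContMDiffAt 𝓘(ℝ, E) 𝓘(ℝ, E) ∞ L (extChartAt I (f x) (f x)) := hLc.contMDiffAt
    have s3 : ContMDiffAt 𝓘(ℝ, E) I ∞ (extChartAt I x).symm (L (extChartAt I (f x) (f x))) := by
      rw [hLa]
      exact (contMDiffOn_extChartAt_symm x).contMDiffAt (extChartAt_target_mem_nhds x)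
    exact s3.comp (f x) (s2.comp (f x) s1)
  refine ⟨g, hgc, hgx, ?_⟩
  have hfg : ContinuousAt (fun z => f (g z)) (f x) :=
    ContinuousAt.comp (by rw [hgx]; exact hf.continuousAt) hgc.continuousAt
  have e1 : ∀ᶠ z in 𝓝 (f x), f (g z) ∈ (extChartAt I (f x)).source :=
    hfg.eventually (by
      simp only [hgx]
      exact extChartAt_source_mem_nhds (f x))
  have e2 := (continuousAt_extChartAt (I := I) (f x)).eventually hFL
  filter_upwards [e1, e2, extChartAt_source_mem_nhds (I := I) (f x)] with z h1 h2 h3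
  exact (extChartAt I (f x)).injOn h1 h3 h2

/-- The inverses of a smooth family of diffeomorphisms form a smooth family. -/
theorem contMDiff_symm_family {E H M : Type*} [NormedAddCommGroup E] [NormedSpace ℝ E]
    [FiniteDimensional ℝ E] [TopologicalSpace H] {I : ModelWithCorners ℝ E H} [I.Boundaryless]
    [TopologicalSpace M] [ChartedSpace H M] [IsManifold I ∞ M] {φ : ℝ → M ≃ₘ⟮I, I⟯ M}
    (hφ : ContMDiff (𝓘(ℝ, ℝ).prod I) I ∞ fun p : ℝ × M => φ p.1 p.2) :
    ContMDiff (𝓘(ℝ, ℝ).prod I) I ∞ fun p : ℝ × M => (φ p.1).symm p.2 := by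
  rintro ⟨t, z⟩
  obtain ⟨y, rfl⟩ := (φ t).surjective z
  -- the inverse family is a component of the inverse of `(t, y) ↦ (t, φ t y)`
  let Φ : ℝ × M → ℝ × M := fun p => (p.1, φ p.1 p.2)
  have hΦ : ContMDiff (𝓘(ℝ, ℝ).prod I) (𝓘(ℝ, ℝ).prod I) ∞ Φ := contMDiff_fst.prodMk hφ
  have hinj : ∀ v : TangentSpace (𝓘(ℝ, ℝ).prod I) (t, y),
      mfderiv (𝓘(ℝ, ℝ).prod I) (𝓘(ℝ, ℝ).prod I) Φ (t, y) v = 0 → v = 0 := by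
    rintro ⟨a, v⟩ hv
    have hd : MDifferentiableAt (𝓘(ℝ, ℝ).prod I) I (fun p : ℝ × M => φ p.1 p.2) (t, y) :=
      hφ.mdifferentiable (by simp) _
    have hp := MDifferentiableAt.mfderiv_prod (x := (t, y))
      (mdifferentiableAt_fst (I := 𝓘(ℝ, ℝ)) (I' := I) (x := (t, y))) hd
    have hv' := (DFunLike.congr_fun hp (a, v)).symm.trans hv
    rw [mfderiv_fst] at hv'
    have ha : a = 0 := congrArg Prod.fst hv'
    subst ha
    have hv2 : mfderiv (𝓘(ℝ, ℝ).prod I) I (fun p : ℝ × M => φ p.1 p.2) (t, y)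
        ((0, v) : ℝ × E) = 0 :=
      congrArg Prod.snd hv'
    have h3 := mfderiv_prod_eq_add_apply (v := ((0, v) : ℝ × E)) hd
    rw [hv2] at h3
    have h4 : mfderiv I I (φ t) y v = 0 := by
      refine Eq.trans ?_ h3.symm
      refine Eq.trans ?_ (congrArg (· + _) (ContinuousLinearMap.map_zero _).symm)
      exact (zero_add _).symm
    have h5 : v = 0 := by
      have := ((φ t).mfderivToContinuousLinearEquiv (by simp) y).map_eq_zero_iff.1 h4
      exact this
    rw [h5]; rfl
  obtain ⟨g, hg, -, hfg⟩ := exists_contMDiffAt_local_rightInverse hΦ.contMDiffAt hinj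
  refine (contMDiffAt_snd.comp _ hg).congr_of_eventuallyEq ?_
  filter_upwards [hfg] with p hp
  have h1 : (Φ (g p)).1 = p.1 := congrArg Prod.fst hp
  have h2 : (Φ (g p)).2 = p.2 := congrArg Prod.snd hp
  change (g p).1 = p.1 at h1
  change φ (g p).1 (g p).2 = p.2 at h2
  rw [h1] at h2
  simp [← h2]

end InverseFunction

/-! ### Hamiltonians of products of flows -/

section Generation

variable {n : ℕ} {Y : Type*} [TopologicalSpace Y] [ChartedSpace (EuclideanSpace ℝ (Fin n)) Y]
  {Ω : SymplecticForm n Y}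

theorem IsSymplectomorphism.trans {f g : Y ≃ₘ⟮𝓡 n, 𝓡 n⟯ Y}
    (hf : IsSymplectomorphism Ω f) (hg : IsSymplectomorphism Ω g) :
    IsSymplectomorphism Ω (f.trans g) := by
  intro y
  have hd : mfderiv (𝓡 n) (𝓡 n) (f.trans g) y =
      (mfderiv (𝓡 n) (𝓡 n) g (f y)).comp (mfderiv (𝓡 n) (𝓡 n) f y) :=
    mfderiv_comp y (g.mdifferentiable (by simp) _) (f.mdifferentiable (by simp) _)
  rw [hd]
  refine Eq.trans ?_ (hf y)
  rw [← hg (f y)]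
  rfl

/-- The product `φ t ∘ ψ t` of two flows is generated by the sum of the Hamiltonian of `φ` and of
that of `ψ`, transported by `φ`: its velocity is the sum of that of `φ` and of the image under `φ t`
of that of `ψ`, and `φ t` preserves `Ω`. -/
theorem GeneratedBy.trans {φ ψ : ℝ → Y ≃ₘ⟮𝓡 n, 𝓡 n⟯ Y} {A B : ℝ → Y → ℝ}
    (hφ : ContMDiff (𝓘(ℝ, ℝ).prod (𝓡 n)) (𝓡 n) ∞ fun p : ℝ × Y => φ p.1 p.2)
    (hψ : ContMDiff (𝓘(ℝ, ℝ).prod (𝓡 n)) (𝓡 n) ∞ fun p : ℝ × Y => ψ p.1 p.2)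
    (hA : ∀ t, MDifferentiable (𝓡 n) 𝓘(ℝ, ℝ) (A t))
    (hB : ∀ t, MDifferentiable (𝓡 n) 𝓘(ℝ, ℝ) (B t))
    (hs : ∀ t, IsSymplectomorphism Ω (φ t))
    (gφ : GeneratedBy Ω (fun t => φ t) A) (gψ : GeneratedBy Ω (fun t => ψ t) B) :
    GeneratedBy Ω (fun t => (ψ t).trans (φ t)) fun t y => A t y + B t ((φ t).symm y) := by
  intro t y w
  let E := EuclideanSpace ℝ (Fin n)
  have dΦ : MDifferentiableAt (𝓘(ℝ, ℝ).prod (𝓡 n)) (𝓡 n) (fun p : ℝ × Y => φ p.1 p.2) (t, ψ t y) :=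
    hφ.mdifferentiable (by simp) _
  have dψ : MDifferentiableAt 𝓘(ℝ, ℝ) (𝓡 n) (fun s => ψ s y) t :=
    (hψ.comp (contMDiff_id.prodMk contMDiff_const)).mdifferentiable (by simp) t
  set a : E := mfderiv 𝓘(ℝ, ℝ) (𝓡 n) (fun s => φ s (ψ t y)) t (1 : ℝ) with ha
  set b : E := mfderiv 𝓘(ℝ, ℝ) (𝓡 n) (fun s => ψ s y) t (1 : ℝ) with hb
  let D : E →L[ℝ] E := mfderiv (𝓡 n) (𝓡 n) (φ t) (ψ t y)
  have hvel : mfderiv 𝓘(ℝ, ℝ) (𝓡 n) (fun s => (ψ s).trans (φ s) y) t (1 : ℝ) = a + D b := by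
    have h1 : mfderiv 𝓘(ℝ, ℝ) (𝓡 n) (fun s => (ψ s).trans (φ s) y) t =
        (mfderiv (𝓘(ℝ, ℝ).prod (𝓡 n)) (𝓡 n) (fun p : ℝ × Y => φ p.1 p.2) (t, ψ t y)).comp
          (mfderiv 𝓘(ℝ, ℝ) (𝓘(ℝ, ℝ).prod (𝓡 n)) (fun s => (s, ψ s y)) t) :=
      mfderiv_comp (I' := 𝓘(ℝ, ℝ).prod (𝓡 n)) t dΦ (mdifferentiableAt_id.prodMk dψ)
    have h2 := MDifferentiableAt.mfderiv_prod (mdifferentiableAt_id (I := 𝓘(ℝ, ℝ)) (x := t)) dψ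
    have h3 := mfderiv_prod_eq_add_apply (v := ((1, b) : ℝ × E)) dΦ
    have h4 : mfderiv 𝓘(ℝ, ℝ) (𝓘(ℝ, ℝ).prod (𝓡 n)) (fun s => (s, ψ s y)) t (1 : ℝ) =
        ((1, b) : ℝ × E) := by
      refine (DFunLike.congr_fun h2 (1 : ℝ)).trans ?_
      rw [mfderiv_id]; rfl
    refine (DFunLike.congr_fun h1 (1 : ℝ)).trans ?_
    exact (congrArg (mfderiv (𝓘(ℝ, ℝ).prod (𝓡 n)) (𝓡 n) (fun p : ℝ × Y => φ p.1 p.2)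
      (t, ψ t y)) h4).trans h3
  obtain ⟨w', hw'⟩ : ∃ w' : E, D w' = w :=
    ((φ t).mfderivToContinuousLinearEquiv (by simp) (ψ t y)).surjective w
  have e1 := gφ t (ψ t y) w
  have e2 := gψ t y w'
  -- the transported Hamiltonian pulls back to the original one
  have dB : MDifferentiableAt (𝓡 n) 𝓘(ℝ, ℝ) (fun z => B t ((φ t).symm z)) (φ t (ψ t y)) :=
    (hB t _).comp _ ((φ t).symm.mdifferentiable (by simp) _)
  let dB' : E →L[ℝ] ℝ :=
    mfderiv (𝓡 n) 𝓘(ℝ, ℝ) (fun z => B t ((φ t).symm z)) (φ t (ψ t y))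
  let dA' : E →L[ℝ] ℝ := mfderiv (𝓡 n) 𝓘(ℝ, ℝ) (A t) (φ t (ψ t y))
  have e3 : dB' (D w') = mfderiv (𝓡 n) 𝓘(ℝ, ℝ) (B t) (ψ t y) w' := by
    have := mfderiv_comp (ψ t y) dB ((φ t).mdifferentiable (by simp) (ψ t y))
    have hc : (fun z => B t ((φ t).symm z)) ∘ φ t = B t := by ext z; simp
    rw [hc] at this
    exact (DFunLike.congr_fun this w').symm
  have e4 : mfderiv (𝓡 n) 𝓘(ℝ, ℝ) (fun z => A t z + B t ((φ t).symm z)) (φ t (ψ t y)) w =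
      dA' w + dB' w :=
    DFunLike.congr_fun (mfderiv_add (hA t (φ t (ψ t y))) dB) w
  have e5 : Ω.form (φ t (ψ t y)) ![D b, D w'] = Ω.form (ψ t y) ![b, w'] := by
    rw [← hs t (ψ t y)]
    refine congrArg (Ω.form (φ t (ψ t y))) ?_
    funext i; fin_cases i <;> rfl
  have e6 : Ω.form (φ t (ψ t y)) ![a + D b, w] =
      Ω.form (φ t (ψ t y)) ![a, w] + Ω.form (φ t (ψ t y)) ![D b, w] := by
    have := (Ω.form (φ t (ψ t y))).map_update_add ![a, w] 0 a (D b)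
    convert this using 2 <;> · congr 1; funext i; fin_cases i <;> rfl
  refine (congrArg (fun v => Ω.form (φ t (ψ t y)) ![v, w]) hvel).trans ?_
  refine e6.trans (Eq.trans ?_ (congrArg Neg.neg e4.symm))
  rw [← hw'] at e1 ⊢
  refine (congrArg₂ (· + ·) e1 (e5.trans e2)).trans ?_
  rw [← e3]
  exact (neg_add _ _).symm

end Generation

/-! ### The topological monoid of Hamiltonian diffeomorphisms and its loops -/

section HamiltonianGroup

variable {n : ℕ} {Y : Type*} [TopologicalSpace Y] [ChartedSpace (EuclideanSpace ℝ (Fin n)) Y]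
  {Ω : SymplecticForm n Y}

/-- An affine change of time multiplies the Hamiltonian by the speed. -/
theorem GeneratedBy.rescale {φ : ℝ → Y ≃ₘ⟮𝓡 n, 𝓡 n⟯ Y} {H : ℝ → Y → ℝ}
    (hφ : ContMDiff (𝓘(ℝ, ℝ).prod (𝓡 n)) (𝓡 n) ∞ fun p : ℝ × Y => φ p.1 p.2)
    (hH : ∀ t, MDifferentiable (𝓡 n) 𝓘(ℝ, ℝ) (H t))
    (g : GeneratedBy Ω (fun t => φ t) H) (c b : ℝ) :
    GeneratedBy Ω (fun t => φ (c * t + b)) fun t y => c * H (c * t + b) y := by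
  intro t y w
  let E := EuclideanSpace ℝ (Fin n)
  have dφ : MDifferentiableAt 𝓘(ℝ, ℝ) (𝓡 n) (fun s => φ s y) (c * t + b) :=
    (hφ.comp (contMDiff_id.prodMk contMDiff_const)).mdifferentiable (by simp) _
  have da : HasDerivAt (fun s : ℝ => c * s + b) c t := by
    simpa using ((hasDerivAt_id t).const_mul c).add_const b
  have h1 : mfderiv 𝓘(ℝ, ℝ) (𝓡 n) (fun s => φ (c * s + b) y) t =
      (mfderiv 𝓘(ℝ, ℝ) (𝓡 n) (fun s => φ s y) (c * t + b)).comp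
        (mfderiv 𝓘(ℝ, ℝ) 𝓘(ℝ, ℝ) (fun s : ℝ => c * s + b) t) :=
    mfderiv_comp t dφ da.differentiableAt.mdifferentiableAt
  set a : E := mfderiv 𝓘(ℝ, ℝ) (𝓡 n) (fun s => φ s y) (c * t + b) (1 : ℝ) with ha
  have hvel : mfderiv 𝓘(ℝ, ℝ) (𝓡 n) (fun s => φ (c * s + b) y) t (1 : ℝ) = c • a := by
    refine (DFunLike.congr_fun h1 (1 : ℝ)).trans ?_
    have h2 : mfderiv 𝓘(ℝ, ℝ) 𝓘(ℝ, ℝ) (fun s : ℝ => c * s + b) t (1 : ℝ) = c • (1 : ℝ) := by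
      rw [mfderiv_eq_fderiv, da.hasFDerivAt.fderiv]
      exact mul_comm (1 : ℝ) c
    exact (congrArg (mfderiv 𝓘(ℝ, ℝ) (𝓡 n) (fun s => φ s y) (c * t + b)) h2).trans
      (ContinuousLinearMap.map_smul _ c (1 : ℝ))
  have e1 : Ω.form (φ (c * t + b) y) ![c • a, w] = c • Ω.form (φ (c * t + b) y) ![a, w] := by
    have := (Ω.form (φ (c * t + b) y)).map_update_smul ![a, w] 0 c a
    convert this using 2
    · funext i; fin_cases i <;> rfl
    · congr 2; funext i; fin_cases i <;> rfl
  have e2 : mfderiv (𝓡 n) 𝓘(ℝ, ℝ) (fun z => c * H (c * t + b) z) (φ (c * t + b) y) w =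
      c • (mfderiv (𝓡 n) 𝓘(ℝ, ℝ) (H (c * t + b)) (φ (c * t + b) y) w : ℝ) :=
    DFunLike.congr_fun (const_smul_mfderiv (hH _ _) c) w
  refine (congrArg (fun v => Ω.form (φ (c * t + b) y) ![v, w]) hvel).trans ?_
  refine e1.trans (Eq.trans ?_ (congrArg Neg.neg e2.symm))
  refine (congrArg (c • ·) (g (c * t + b) y w)).trans ?_
  exact smul_neg c _

theorem IsHamiltonianFlow.rescale {φ : ℝ → Y ≃ₘ⟮𝓡 n, 𝓡 n⟯ Y} {H : ℝ → Y → ℝ}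
    (hφ : IsHamiltonianFlow Ω φ H) (c : ℝ) :
    IsHamiltonianFlow Ω (fun t => φ (c * t + 0)) fun t y => c * H (c * t + 0) y := by
  have hc : ContMDiff (𝓘(ℝ, ℝ).prod (𝓡 n)) 𝓘(ℝ, ℝ) ∞ fun p : ℝ × Y => c * p.1 + 0 :=
    ((contDiff_const.mul contDiff_id).add contDiff_const).contMDiff.comp contMDiff_fst
  exact
  { smooth_hamiltonian := contMDiff_const.mul
      (hφ.smooth_hamiltonian.comp (hc.prodMk contMDiff_snd))
    smooth := hφ.smooth.comp (hc.prodMk contMDiff_snd)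
    symplectic := fun t => hφ.symplectic _
    zero := fun y => by simp [hφ.zero]
    generated := GeneratedBy.rescale hφ.smooth
      (fun t => (hφ.smooth_hamiltonian.comp (contMDiff_const.prodMk contMDiff_id)).mdifferentiable
        (by simp)) hφ.generated c 0 }

@[ext]
theorem HamDiffeo.ext {f g : HamDiffeo Ω} (h : ∀ y, f y = g y) : f = g :=
  Subtype.ext (Diffeomorph.ext h)

variable [IsManifold (𝓡 n) ∞ Y]

theorem IsHamiltonianFlow.trans {φ ψ : ℝ → Y ≃ₘ⟮𝓡 n, 𝓡 n⟯ Y} {A B : ℝ → Y → ℝ}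
    (hφ : IsHamiltonianFlow Ω φ A) (hψ : IsHamiltonianFlow Ω ψ B) :
    IsHamiltonianFlow Ω (fun t => (ψ t).trans (φ t)) fun t y => A t y + B t ((φ t).symm y) where
  smooth_hamiltonian := hφ.smooth_hamiltonian.add
    (hψ.smooth_hamiltonian.comp (contMDiff_fst.prodMk (contMDiff_symm_family hφ.smooth)))
  smooth := hφ.smooth.comp (contMDiff_fst.prodMk hψ.smooth)
  symplectic t := (hψ.symplectic t).trans (hφ.symplectic t)
  zero y := by simp [hψ.zero, hφ.zero]
  generated := GeneratedBy.trans hφ.smooth hψ.smooth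
    (fun t => (hφ.smooth_hamiltonian.comp (contMDiff_const.prodMk contMDiff_id)).mdifferentiable
      (by simp))
    (fun t => (hψ.smooth_hamiltonian.comp (contMDiff_const.prodMk contMDiff_id)).mdifferentiable
      (by simp)) hφ.symplectic hφ.generated hψ.generated

/-- Hamiltonian diffeomorphisms form a monoid under composition. (They form a group, but the
inverse is not needed.) -/
noncomputable instance HamDiffeo.instMonoid : Monoid (HamDiffeo Ω) where
  mul f g := ⟨g.1.trans f.1, g.2.1.trans f.2.1, by
    obtain ⟨φ, A, hφ, e⟩ := f.2.2
    obtain ⟨ψ, B, hψ, e'⟩ := g.2.2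
    exact ⟨_, _, hφ.trans hψ, by rw [e, e']⟩⟩
  one := HamDiffeo.id Ω
  mul_assoc _ _ _ := rfl
  one_mul _ := rfl
  mul_one _ := rfl

theorem HamDiffeo.mul_apply (f g : HamDiffeo Ω) (y : Y) : (f * g) y = f (g y) := rfl

theorem HamDiffeo.continuous_iff {Z : Type*} [TopologicalSpace Z] {f : Z → HamDiffeo Ω} :
    Continuous f ↔
      ∀ k, Continuous[inferInstance, ckTopology k (𝓡 n) Y] fun z => (f z : Y → Y) := by
  rw [continuous_induced_rng, continuous_iInf_rng]
  rfl

instance HamDiffeo.instContinuousMul : ContinuousMul (HamDiffeo Ω) where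
  continuous_mul := by
    rw [HamDiffeo.continuous_iff]
    intro k
    exact continuous_ckTopology_comp k (𝓡 n) (f := fun z : HamDiffeo Ω × HamDiffeo Ω => z.1)
      (g := fun z => z.2) (fun z => z.1.1.contMDiff) (fun z => z.2.1.contMDiff)
      (HamDiffeo.continuous_iff.1 continuous_fst k) (HamDiffeo.continuous_iff.1 continuous_snd k)

/-- The flow of a Hamiltonian diffeomorphism runs in `G`, since each of its maps is the time-one map
of a rescaled flow; hence `G` is connected by paths. -/
theorem HamDiffeo.joined_one (g : HamDiffeo Ω) : Joined g 1 := by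
  obtain ⟨φ, H, hφ, e⟩ := g.2.2
  let c : ℝ → HamDiffeo Ω := fun t =>
    ⟨φ t, hφ.symplectic t, _, _, hφ.rescale t, by simp⟩
  have hc : Continuous c := HamDiffeo.continuous_iff.2 fun k =>
    continuous_ckTopology_of_contMDiff k (𝓡 n) hφ.smooth
  have h0 : c 0 = 1 := HamDiffeo.ext fun y => hφ.zero y
  have h1 : c 1 = g := Subtype.ext e
  exact Joined.symm ⟨⟨⟨fun t => c t, by fun_prop⟩, by simpa using h0, by simpa using h1⟩⟩

/-- In a topological monoid, the pointwise product of two loops based at the identity is homotopic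
to their concatenation: delay the first loop and hurry the second one. -/
theorem Path.homotopic_mul_trans {X : Type*} [Monoid X] [TopologicalSpace X] [ContinuousMul X]
    (p q : Path (1 : X) 1) :
    ((p.mul q).cast (one_mul 1).symm (one_mul 1).symm).Homotopic (q.trans p) := by
  have h : (((Path.refl 1).trans p).mul (q.trans (Path.refl 1))).cast
      (one_mul 1).symm (one_mul 1).symm = q.trans p := by
    ext t
    simp only [Path.cast_coe, Path.mul_apply, Path.trans_apply]
    split_ifs <;> simp
  rw [← h]
  refine Path.Homotopic.pathCast ?_ _ _
  exact Path.Homotopic.map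
    ⟨Path.Homotopic.prodHomotopy (Path.Homotopy.reflTrans p).symm (Path.Homotopy.transRefl q).symm⟩
    ⟨fun x : X × X => x.1 * x.2, continuous_mul⟩

theorem Represents.mul {a b : UnitAddCircle → HamDiffeo Ω}
    {γ δ : FundamentalGroup (HamDiffeo Ω) (HamDiffeo.id Ω)} (ha : Represents a γ)
    (hb : Represents b δ) : Represents (fun t => a t * b t) (γ * δ) := by
  obtain ⟨p, rfl, F, hF0, hF1⟩ := ha
  obtain ⟨q, rfl, G, hG0, hG1⟩ := hb
  refine ⟨(Path.mul p q).cast (one_mul 1).symm (one_mul 1).symm, ?_, F * G, ?_, ?_⟩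
  · exact Path.Homotopic.Quotient.eq.2 (Path.homotopic_mul_trans (X := HamDiffeo Ω) p q)
  · intro t
    simp [hF0, hG0]
  · intro t
    simp [hF1, hG1]

theorem Represents.const (g : HamDiffeo Ω) :
    Represents (fun _ => g) (1 : FundamentalGroup (HamDiffeo Ω) (HamDiffeo.id Ω)) := by
  obtain ⟨c⟩ := g.joined_one
  refine ⟨Path.refl _, rfl, ⟨fun x => c x.1, by fun_prop⟩, fun t => by simp, fun t => ?_⟩
  simp
  rfl

theorem Represents.rotate {a : UnitAddCircle → HamDiffeo Ω}
    {γ : FundamentalGroup (HamDiffeo Ω) (HamDiffeo.id Ω)} (ha : Represents a γ) (β : ℝ) :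
    Represents (fun t => a (t + (β : UnitAddCircle))) γ := by
  obtain ⟨p, hp, F, hF0, hF1⟩ := ha
  refine ⟨p, hp, ⟨fun x => F (x.1, x.2 + (((1 - x.1) * β : ℝ) : UnitAddCircle)), ?_⟩,
    fun t => ?_, fun t => ?_⟩
  · have : Continuous fun r : ℝ => (r : UnitAddCircle) := AddCircle.continuous_mk' 1
    fun_prop
  · simp [hF0]
  · simp [hF1]

end HamiltonianGroup

/-! ### Invariance and finiteness of the Liouville measure -/

section LiouvilleMeasure

variable {n : ℕ} {Y : Type*} [TopologicalSpace Y] [ChartedSpace (EuclideanSpace ℝ (Fin n)) Y]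
  {Ω : SymplecticForm n Y}

/-- The Gram determinant of an alternating form changes by the square of the determinant under a
linear change of variables. -/
theorem det_gram_compContinuousLinearMap (η : EuclideanSpace ℝ (Fin n) [⋀^Fin 2]→L[ℝ] ℝ)
    (J : EuclideanSpace ℝ (Fin n) →L[ℝ] EuclideanSpace ℝ (Fin n)) :
    (Matrix.of fun i j : Fin n => η.compContinuousLinearMap J
      ![EuclideanSpace.single i (1 : ℝ), EuclideanSpace.single j (1 : ℝ)]).det =
    J.det ^ 2 * (Matrix.of fun i j : Fin n => η
      ![EuclideanSpace.single i (1 : ℝ), EuclideanSpace.single j (1 : ℝ)]).det := by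
  let E := EuclideanSpace ℝ (Fin n)
  let B : LinearMap.BilinForm ℝ E := LinearMap.mk₂ ℝ (fun v w => η ![v, w])
    (fun a b w => by
      have := η.map_update_add ![a, w] 0 a b
      convert this using 2 <;> · congr 1; funext i; fin_cases i <;> rfl)
    (fun c a w => by
      have := η.map_update_smul ![a, w] 0 c a
      convert this using 2
      · funext i; fin_cases i <;> rfl
      · congr 2; funext i; fin_cases i <;> rfl)
    (fun w a b => by
      have := η.map_update_add ![w, a] 1 a b
      convert this using 2 <;> · congr 1; funext i; fin_cases i <;> rfl)
    (fun c w a => by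
      have := η.map_update_smul ![w, a] 1 c a
      convert this using 2
      · funext i; fin_cases i <;> rfl
      · congr 2; funext i; fin_cases i <;> rfl)
  let b := (EuclideanSpace.basisFun (Fin n) ℝ).toBasis
  have h1 : (Matrix.of fun i j : Fin n => η
      ![EuclideanSpace.single i (1 : ℝ), EuclideanSpace.single j (1 : ℝ)]) =
      LinearMap.BilinForm.toMatrix b B := by
    ext i j
    simp [LinearMap.BilinForm.toMatrix_apply, B, b]
  have h2 : (Matrix.of fun i j : Fin n => η.compContinuousLinearMap J
      ![EuclideanSpace.single i (1 : ℝ), EuclideanSpace.single j (1 : ℝ)]) =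
      LinearMap.BilinForm.toMatrix b (B.comp (J : E →ₗ[ℝ] E) (J : E →ₗ[ℝ] E)) := by
    ext i j
    simp only [LinearMap.BilinForm.toMatrix_apply, B, b, Matrix.of_apply]
    simp only [OrthonormalBasis.coe_toBasis, EuclideanSpace.basisFun_apply,
      LinearMap.BilinForm.comp_apply, LinearMap.mk₂_apply]
    refine congrArg η ?_
    funext i; fin_cases i <;> rfl
  rw [h1, h2, LinearMap.BilinForm.toMatrix_comp b b, Matrix.det_mul, Matrix.det_mul,
    Matrix.det_transpose, LinearMap.det_toMatrix]
  change LinearMap.det (J : E →ₗ[ℝ] E) * _ * LinearMap.det (J : E →ₗ[ℝ] E) = _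
  rw [ContinuousLinearMap.det]
  ring

theorem continuousOn_liouvilleDensity (Ω : SymplecticForm n Y) (x : Y) :
    ContinuousOn (liouvilleDensity Ω x) (extChartAt (𝓡 n) x).target := by
  refine Real.continuous_sqrt.comp_continuousOn ?_
  refine (Continuous.matrix_det continuous_id).comp_continuousOn ?_
  refine continuousOn_pi.2 fun i => continuousOn_pi.2 fun j => ?_
  exact (continuous_eval_const _).comp_continuousOn (Ω.smooth x).continuousOn

/-- Only the part of `S` in the chart domain counts, although `(extChartAt (𝓡 n) x).symm` has junk
values outside of the target. -/
theorem liouvilleInChart_apply [MeasurableSpace Y] [BorelSpace Y] (Ω : SymplecticForm n Y) (x : Y)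
    {S : Set Y} (hS : MeasurableSet S) :
    liouvilleInChart Ω x S =
      ∫⁻ u in extChartAt (𝓡 n) x '' ((extChartAt (𝓡 n) x).source ∩ S),
        ENNReal.ofReal (liouvilleDensity Ω x u) := by
  have hm : AEMeasurable (extChartAt (𝓡 n) x).symm
      ((volume.restrict (extChartAt (𝓡 n) x).target).withDensity
        fun u => ENNReal.ofReal (liouvilleDensity Ω x u)) :=
    ((continuousOn_extChartAt_symm x).aemeasurable
      (isOpen_extChartAt_target x).measurableSet).mono_ac (withDensity_absolutelyContinuous _ _)
  rw [liouvilleInChart, Measure.map_apply_of_aemeasurable hm hS, withDensity_apply',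
    Measure.restrict_restrict' (isOpen_extChartAt_target x).measurableSet, Set.inter_comm,
    ← PartialEquiv.image_source_inter_eq']

theorem measurableSet_extChartAt_image [MeasurableSpace Y] [BorelSpace Y] {x : Y} {S : Set Y}
    (hS : MeasurableSet S) :
    MeasurableSet (extChartAt (𝓡 n) x '' ((extChartAt (𝓡 n) x).source ∩ S)) := by
  rw [PartialEquiv.image_source_inter_eq', ← Subtype.image_preimage_val]
  exact (isOpen_extChartAt_target x).measurableSet.subtype_image
    ((continuousOn_extChartAt_symm x).domRestrict.measurable hS)

variable [IsManifold (𝓡 n) ∞ Y]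

/-- The expression of a map `g` in the preferred charts at `x` and at `x'`. -/
noncomputable def chartTransfer (g : Y → Y) (x x' : Y) (u : EuclideanSpace ℝ (Fin n)) :
    EuclideanSpace ℝ (Fin n) :=
  extChartAt (𝓡 n) x' (g ((extChartAt (𝓡 n) x).symm u))

theorem mdifferentiableAt_extChartAt_symm {x : Y} {u : EuclideanSpace ℝ (Fin n)}
    (hu : u ∈ (extChartAt (𝓡 n) x).target) :
    MDifferentiableAt 𝓘(ℝ, EuclideanSpace ℝ (Fin n)) (𝓡 n) (extChartAt (𝓡 n) x).symm u :=
  ((contMDiffOn_extChartAt_symm (n := ∞) x).contMDiffAt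
    ((isOpen_extChartAt_target x).mem_nhds hu)).mdifferentiableAt (by simp)

theorem differentiableAt_chartTransfer (g : Y ≃ₘ⟮𝓡 n, 𝓡 n⟯ Y) {x x' : Y}
    {u : EuclideanSpace ℝ (Fin n)} (hu : u ∈ (extChartAt (𝓡 n) x).target)
    (hu' : g ((extChartAt (𝓡 n) x).symm u) ∈ (extChartAt (𝓡 n) x').source) :
    DifferentiableAt ℝ (chartTransfer g x x') u := by
  rw [← mdifferentiableAt_iff_differentiableAt]
  refine MDifferentiableAt.comp u (I' := 𝓡 n) ?_
    (MDifferentiableAt.comp u (I' := 𝓡 n) (g.mdifferentiable (by simp) _)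
      (mdifferentiableAt_extChartAt_symm hu))
  exact mdifferentiableAt_extChartAt (by simpa using hu')

/-- A symplectomorphism, expressed in charts, pulls back the symplectic form to itself. -/
theorem formInChart_eq_pullback {g : Y ≃ₘ⟮𝓡 n, 𝓡 n⟯ Y} (hg : IsSymplectomorphism Ω g) {x x' : Y}
    {u : EuclideanSpace ℝ (Fin n)} (hu : u ∈ (extChartAt (𝓡 n) x).target)
    (hu' : g ((extChartAt (𝓡 n) x).symm u) ∈ (extChartAt (𝓡 n) x').source) :
    formInChart Ω.form x u =
      (formInChart Ω.form x' (chartTransfer g x x' u)).compContinuousLinearMap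
        (fderiv ℝ (chartTransfer g x x') u) := by
  let E := EuclideanSpace ℝ (Fin n)
  let η : Y → E [⋀^Fin 2]→L[ℝ] ℝ := Ω.form
  set y := (extChartAt (𝓡 n) x).symm u with hy
  let D₁ : E →L[ℝ] E := mfderiv 𝓘(ℝ, E) (𝓡 n) (extChartAt (𝓡 n) x).symm u
  let D₂ : E →L[ℝ] E := mfderiv (𝓡 n) (𝓡 n) g y
  let D₃ : E →L[ℝ] E :=
    mfderiv 𝓘(ℝ, E) (𝓡 n) (extChartAt (𝓡 n) x').symm (chartTransfer g x x' u)
  have hpt : (extChartAt (𝓡 n) x').symm (chartTransfer g x x' u) = g y :=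
    (extChartAt (𝓡 n) x').left_inv hu'
  have hd : D₃.comp (fderiv ℝ (chartTransfer g x x') u) = D₂.comp D₁ := by
    have h1 : mfderiv 𝓘(ℝ, E) (𝓡 n) (g ∘ (extChartAt (𝓡 n) x).symm) u = D₂.comp D₁ :=
      mfderiv_comp u (g.mdifferentiable (by simp) _) (mdifferentiableAt_extChartAt_symm hu)
    have h2 : mfderiv 𝓘(ℝ, E) (𝓡 n) ((extChartAt (𝓡 n) x').symm ∘ chartTransfer g x x') u =
        D₃.comp (mfderiv 𝓘(ℝ, E) 𝓘(ℝ, E) (chartTransfer g x x') u) :=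
      mfderiv_comp u
        (mdifferentiableAt_extChartAt_symm ((extChartAt (𝓡 n) x').map_source hu'))
        (differentiableAt_chartTransfer g hu hu').mdifferentiableAt
    rw [mfderiv_eq_fderiv] at h2
    have h3 : (extChartAt (𝓡 n) x').symm ∘ chartTransfer g x x' =ᶠ[𝓝 u]
        g ∘ (extChartAt (𝓡 n) x).symm := by
      have hc : ContinuousAt (fun v => g ((extChartAt (𝓡 n) x).symm v)) u :=
        g.continuous.continuousAt.comp (mdifferentiableAt_extChartAt_symm hu).continuousAt
      filter_upwards [hc.eventually ((isOpen_extChartAt_source x').mem_nhds hu')] with v hv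
      exact (extChartAt (𝓡 n) x').left_inv hv
    exact h2.symm.trans (h3.mfderiv_eq.trans h1)
  have h4 : η y = (η (g y)).compContinuousLinearMap D₂ := (hg y).symm
  have h5 : (η (g y)).compContinuousLinearMap (D₂.comp D₁) =
      (η (g y)).compContinuousLinearMap (D₃.comp (fderiv ℝ (chartTransfer g x x') u)) := by
    rw [hd]
  rw [← hpt] at h5
  change (η y).compContinuousLinearMap D₁ = _
  rw [h4, ← hpt]
  exact h5

theorem liouvilleDensity_eq {g : Y ≃ₘ⟮𝓡 n, 𝓡 n⟯ Y} (hg : IsSymplectomorphism Ω g) {x x' : Y}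
    {u : EuclideanSpace ℝ (Fin n)} (hu : u ∈ (extChartAt (𝓡 n) x).target)
    (hu' : g ((extChartAt (𝓡 n) x).symm u) ∈ (extChartAt (𝓡 n) x').source) :
    liouvilleDensity Ω x u = |(fderiv ℝ (chartTransfer g x x') u).det| *
      liouvilleDensity Ω x' (chartTransfer g x x' u) := by
  rw [liouvilleDensity, formInChart_eq_pullback hg hu hu', det_gram_compContinuousLinearMap,
    Real.sqrt_mul (sq_nonneg _), Real.sqrt_sq_eq_abs]
  rfl

variable [MeasurableSpace Y] [BorelSpace Y]

/-- Change of variables: symplectomorphisms match the Liouville measures of the charts. -/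
theorem liouvilleInChart_image {g : Y ≃ₘ⟮𝓡 n, 𝓡 n⟯ Y} (hg : IsSymplectomorphism Ω g) {x x' : Y}
    {S : Set Y} (hS : MeasurableSet S) (h : S ⊆ (extChartAt (𝓡 n) x).source)
    (h' : g '' S ⊆ (extChartAt (𝓡 n) x').source) :
    liouvilleInChart Ω x' (g '' S) = liouvilleInChart Ω x S := by
  have hgS : MeasurableSet (g '' S) := g.toHomeomorph.measurableEmbedding.measurableSet_image.2 hS
  have hA := measurableSet_extChartAt_image (n := n) (x := x) hS
  rw [liouvilleInChart_apply Ω x' hgS, liouvilleInChart_apply Ω x hS]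
  rw [Set.inter_eq_self_of_subset_right h] at hA ⊢
  rw [Set.inter_eq_self_of_subset_right h']
  have hmem : ∀ u ∈ extChartAt (𝓡 n) x '' S, u ∈ (extChartAt (𝓡 n) x).target ∧
      (extChartAt (𝓡 n) x).symm u ∈ S := by
    rintro _ ⟨y, hy, rfl⟩
    refine ⟨(extChartAt (𝓡 n) x).map_source (h hy), ?_⟩
    rwa [(extChartAt (𝓡 n) x).left_inv (h hy)]
  have himg : extChartAt (𝓡 n) x' '' (g '' S) =
      chartTransfer g x x' '' (extChartAt (𝓡 n) x '' S) := by
    simp only [Set.image_image]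
    refine Set.image_congr fun y hy => ?_
    rw [chartTransfer, (extChartAt (𝓡 n) x).left_inv (h hy)]
  have hinj : Set.InjOn (chartTransfer g x x') (extChartAt (𝓡 n) x '' S) := by
    intro u hu v hv huv
    have h1 := (extChartAt (𝓡 n) x').injOn (h' (Set.mem_image_of_mem g (hmem u hu).2))
      (h' (Set.mem_image_of_mem g (hmem v hv).2)) huv
    exact (extChartAt (𝓡 n) x).symm.injOn (hmem u hu).1 (hmem v hv).1 (g.injective h1)
  rw [himg, lintegral_image_eq_lintegral_abs_det_fderiv_mul volume hA
    (fun u hu => (differentiableAt_chartTransfer g (hmem u hu).1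
      (h' (Set.mem_image_of_mem g (hmem u hu).2))).hasFDerivAt.hasFDerivWithinAt) hinj]
  refine setLIntegral_congr_fun hA fun u hu => ?_
  rw [liouvilleDensity_eq hg (hmem u hu).1 (h' (Set.mem_image_of_mem g (hmem u hu).2)),
    ENNReal.ofReal_mul (abs_nonneg _)]

/-- In the domain of a chart, the Liouville measure is the one computed in that chart. -/
theorem liouville_apply (Ω : SymplecticForm n Y) {x : Y} {S : Set Y} (hS : MeasurableSet S)
    (h : S ⊆ (extChartAt (𝓡 n) x).source) : liouville Ω S = liouvilleInChart Ω x S := by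
  have hU := (isOpen_extChartAt_source (I := 𝓡 n) x).measurableSet
  refine le_antisymm ?_ (le_iSup (liouvilleInChart Ω) x S)
  -- `ν` agrees with the chart measure on the chart domain, and it dominates every chart measure
  let ν := (liouvilleInChart Ω x).restrict (extChartAt (𝓡 n) x).source +
    (liouville Ω).restrict (extChartAt (𝓡 n) x).sourceᶜ
  have hν : liouville Ω ≤ ν := by
    refine iSup_le fun x' => Measure.le_iff.2 fun T hT => ?_
    have hU' := (isOpen_extChartAt_source (I := 𝓡 n) x').measurableSet
    rw [← measure_inter_add_sdiff T hU, Measure.add_apply, Measure.restrict_apply hT,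
      Measure.restrict_apply hT]
    refine add_le_add ?_ (le_iSup (liouvilleInChart Ω) x' _)
    have e1 : liouvilleInChart Ω x' (T ∩ (extChartAt (𝓡 n) x).source) =
        liouvilleInChart Ω x' (T ∩ (extChartAt (𝓡 n) x).source ∩ (extChartAt (𝓡 n) x').source) := by
      rw [liouvilleInChart_apply Ω x' (hT.inter hU),
        liouvilleInChart_apply Ω x' ((hT.inter hU).inter hU')]
      congr 3
      ext y
      simp only [Set.mem_inter_iff]
      tauto
    have e2 := liouvilleInChart_image (isSymplectomorphism_refl Ω) (x := x') (x' := x)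
      ((hT.inter hU).inter hU') Set.inter_subset_right
      (by rw [Diffeomorph.coe_refl, Set.image_id]; exact fun y hy => hy.1.2)
    rw [Diffeomorph.coe_refl, Set.image_id] at e2
    rw [e1, ← e2]
    exact measure_mono Set.inter_subset_left
  refine (hν S).trans ?_
  have e : S ∩ (extChartAt (𝓡 n) x).sourceᶜ = ∅ := by
    rw [← Set.sdiff_eq, Set.sdiff_eq_empty]; exact h
  rw [Measure.add_apply, Measure.restrict_apply hS, Measure.restrict_apply hS, e, measure_empty,
    add_zero]
  exact measure_mono Set.inter_subset_left

instance isLocallyFiniteMeasure_liouville (Ω : SymplecticForm n Y) :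
    IsLocallyFiniteMeasure (liouville Ω) := by
  refine ⟨fun x => ?_⟩
  obtain ⟨r, hr, hrt⟩ := Metric.nhds_basis_closedBall.mem_iff.1
    (extChartAt_target_mem_nhds (I := 𝓡 n) x)
  let V : Set Y := (extChartAt (𝓡 n) x).source ∩
    extChartAt (𝓡 n) x ⁻¹' Metric.ball (extChartAt (𝓡 n) x x) r
  have hVo : IsOpen V := (continuousOn_extChartAt x).isOpen_inter_preimage
    (isOpen_extChartAt_source x) Metric.isOpen_ball
  refine ⟨V, hVo.mem_nhds ⟨mem_extChartAt_source x, Metric.mem_ball_self hr⟩, ?_⟩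
  rw [liouville_apply Ω hVo.measurableSet Set.inter_subset_left,
    liouvilleInChart_apply Ω x hVo.measurableSet]
  refine lt_of_le_of_lt (lintegral_mono_set (t := Metric.closedBall (extChartAt (𝓡 n) x x) r) ?_) ?_
  · rintro _ ⟨y, hy, rfl⟩
    exact Metric.ball_subset_closedBall hy.2.2
  · exact (((continuousOn_liouvilleDensity Ω x).mono hrt).integrableOn_compact
      (isCompact_closedBall _ _)).lintegral_lt_top

/-- Symplectomorphisms preserve the Liouville measure. -/
theorem IsSymplectomorphism.measurePreserving [CompactSpace Y] {g : Y ≃ₘ⟮𝓡 n, 𝓡 n⟯ Y}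
    (hg : IsSymplectomorphism Ω g) : MeasurePreserving g (liouville Ω) (liouville Ω) := by
  let e : Y ≃ᵐ Y := g.toHomeomorph.toMeasurableEquiv
  suffices h : MeasurePreserving e.symm (liouville Ω) (liouville Ω) from h.symm
  refine ⟨e.symm.measurable, ?_⟩
  let U : Y → Set Y := fun y => (extChartAt (𝓡 n) y).source ∩ g ⁻¹' (extChartAt (𝓡 n) (g y)).source
  have hUo : ∀ y, IsOpen (U y) := fun y => (isOpen_extChartAt_source y).inter
    ((isOpen_extChartAt_source (g y)).preimage g.continuous)
  obtain ⟨t, ht⟩ := isCompact_univ.elim_finite_subcover U hUo fun y _ =>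
    Set.mem_iUnion.2 ⟨y, mem_extChartAt_source y, mem_extChartAt_source (g y)⟩
  have key := (Measure.restrict_biUnion_finset_congr (s := t) (t := U)
    (μ := (liouville Ω).map e.symm) (ν := liouville Ω)).2 fun y _ => ?_
  · rwa [Set.univ_subset_iff.1 ht, Measure.restrict_univ, Measure.restrict_univ] at key
  · ext S hS
    have hSU := hS.inter (hUo y).measurableSet
    have him : e.symm ⁻¹' (S ∩ U y) = g '' (S ∩ U y) :=
      (e.toEquiv.image_eq_preimage_symm _).symm
    have hsub : g '' (S ∩ U y) ⊆ (extChartAt (𝓡 n) (g y)).source := by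
      rintro _ ⟨z, hz, rfl⟩; exact hz.2.2
    have hgS : MeasurableSet (g '' (S ∩ U y)) :=
      g.toHomeomorph.measurableEmbedding.measurableSet_image.2 hSU
    rw [Measure.restrict_apply hS, Measure.restrict_apply hS, e.symm.map_apply, him,
      liouville_apply Ω hgS hsub,
      liouvilleInChart_image hg hSU (fun z hz => hz.2.1) hsub,
      liouville_apply Ω hSU (fun z hz => hz.2.1)]

end LiouvilleMeasure

/-! ### Hamiltonians of loops and of iterated skew products -/

section Loops

variable {n : ℕ} {Y : Type*} [TopologicalSpace Y] [ChartedSpace (EuclideanSpace ℝ (Fin n)) Y]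
  {Ω : SymplecticForm n Y}

theorem IsNormalizedHamiltonian.contMDiff [MeasurableSpace Y] {h : UnitAddCircle → HamDiffeo Ω}
    {H : UnitAddCircle → Y → ℝ} (hH : IsNormalizedHamiltonian h H) (t : UnitAddCircle) :
    ContMDiff (𝓡 n) 𝓘(ℝ, ℝ) ∞ (H t) := by
  obtain ⟨r, rfl⟩ := QuotientAddGroup.mk_surjective t
  exact hH.smooth.comp (contMDiff_const.prodMk contMDiff_id)

theorem IsNormalizedHamiltonian.const [MeasurableSpace Y] (g : HamDiffeo Ω) :
    IsNormalizedHamiltonian (fun _ => g) fun _ _ => 0 where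
  smooth := contMDiff_const
  generated t y w := by
    have h0 : mfderiv 𝓘(ℝ, ℝ) (𝓡 n) (fun _ : ℝ => g y) t (1 : ℝ) = 0 := by
      rw [mfderiv_const]; rfl
    have h1 : mfderiv (𝓡 n) 𝓘(ℝ, ℝ) (fun _ : Y => (0 : ℝ)) (g y) w = 0 := by
      rw [mfderiv_const]; rfl
    have h2 : Ω.form (g y) ![0, w] = 0 := (Ω.form (g y)).map_coord_zero 0 rfl
    exact ((congrArg (fun v => Ω.form (g y) ![v, w]) h0).trans h2).trans
      ((neg_eq_zero.2 h1).symm)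
  normalized _ := integral_zero _ _

theorem IsSmoothLoop.const [MeasurableSpace Y] (g : HamDiffeo Ω) : IsSmoothLoop fun _ => g where
  smooth := g.1.contMDiff.comp contMDiff_snd
  velocity := ⟨_, .const g⟩

theorem contMDiff_translate (β : ℝ) :
    ContMDiff (𝓘(ℝ, ℝ).prod (𝓡 n)) (𝓘(ℝ, ℝ).prod (𝓡 n)) ∞ fun p : ℝ × Y => (p.1 + β, p.2) :=
  ((contDiff_id.add contDiff_const).contMDiff.comp contMDiff_fst).prodMk contMDiff_snd

theorem IsNormalizedHamiltonian.rotate [MeasurableSpace Y] {h : UnitAddCircle → HamDiffeo Ω}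
    {H : UnitAddCircle → Y → ℝ} (hH : IsNormalizedHamiltonian h H) (hh : IsSmoothLoop h) (β : ℝ) :
    IsNormalizedHamiltonian (fun t => h (t + (β : UnitAddCircle)))
      fun t => H (t + (β : UnitAddCircle)) where
  smooth := hH.smooth.comp (contMDiff_translate β)
  generated := by
    have := GeneratedBy.rescale (φ := fun t : ℝ => (h (t : UnitAddCircle)).1) hh.smooth
      (fun t => (hH.contMDiff t).mdifferentiable (by simp)) hH.generated 1 β
    simp only [one_mul] at this
    exact this
  normalized t := hH.normalized _

theorem IsSmoothLoop.rotate [MeasurableSpace Y] {h : UnitAddCircle → HamDiffeo Ω}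
    (hh : IsSmoothLoop h) (β : ℝ) : IsSmoothLoop fun t => h (t + (β : UnitAddCircle)) where
  smooth := hh.smooth.comp (contMDiff_translate β)
  velocity := let ⟨_, hH⟩ := hh.velocity; ⟨_, hH.rotate hh β⟩

theorem continuous_hamiltonian_along_loop [MeasurableSpace Y] {h : UnitAddCircle → HamDiffeo Ω}
    (hh : IsSmoothLoop h) {H : UnitAddCircle → Y → ℝ} (hH : IsNormalizedHamiltonian h H) :
    Continuous fun x : UnitAddCircle × Y => H x.1 (h x.1 x.2) := by
  -- smoothness is that of the lift to `ℝ × Y`, of which `S¹ × Y` is a quotient space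
  have hq : IsOpenQuotientMap fun p : ℝ × Y => ((p.1 : UnitAddCircle), p.2) :=
    (QuotientAddGroup.isOpenQuotientMap_mk (G := ℝ)).prodMap .id
  rw [hq.isQuotientMap.continuous_iff]
  exact hH.smooth.continuous.comp (continuous_fst.prodMk hh.smooth.continuous)

variable [IsManifold (𝓡 n) ∞ Y] [CompactSpace Y] [MeasurableSpace Y] [BorelSpace Y]

theorem HamDiffeo.integral_comp (g : HamDiffeo Ω) (f : Y → ℝ) :
    ∫ y, f (g y) ∂(liouville Ω) = ∫ y, f y ∂(liouville Ω) :=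
  g.2.1.measurePreserving.integral_comp g.1.toHomeomorph.measurableEmbedding f

/-- The Hamiltonian of a product of loops has zero mean because the first loop acts by
maps which preserve the Liouville measure. -/
theorem IsNormalizedHamiltonian.mul {a b : UnitAddCircle → HamDiffeo Ω}
    {A B : UnitAddCircle → Y → ℝ} (hA : IsNormalizedHamiltonian a A)
    (hB : IsNormalizedHamiltonian b B) (ha : IsSmoothLoop a) (hb : IsSmoothLoop b) :
    IsNormalizedHamiltonian (fun t => a t * b t) fun t y => A t y + B t ((a t).1.symm y) where
  smooth := hA.smooth.add (hB.smooth.comp (contMDiff_fst.prodMk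
    (contMDiff_symm_family (φ := fun t : ℝ => (a (t : UnitAddCircle)).1) ha.smooth)))
  generated := GeneratedBy.trans (φ := fun t : ℝ => (a (t : UnitAddCircle)).1)
    (ψ := fun t : ℝ => (b (t : UnitAddCircle)).1) ha.smooth hb.smooth
    (fun t => (hA.contMDiff t).mdifferentiable (by simp))
    (fun t => (hB.contMDiff t).mdifferentiable (by simp)) (fun t => (a t).2.1)
    hA.generated hB.generated
  normalized t := by
    have cA : Continuous (A t) := (hA.contMDiff t).continuous
    have cB : Continuous fun y => B t ((a t).1.symm y) :=
      (hB.contMDiff t).continuous.comp (a t).1.symm.continuous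
    rw [integral_add (cA.integrable_of_hasCompactSupport (.of_compactSpace _))
      (cB.integrable_of_hasCompactSupport (.of_compactSpace _)), hA.normalized t, zero_add,
      ← (a t).integral_comp]
    simpa using hB.normalized t

theorem IsSmoothLoop.mul {a b : UnitAddCircle → HamDiffeo Ω} (ha : IsSmoothLoop a)
    (hb : IsSmoothLoop b) : IsSmoothLoop fun t => a t * b t where
  smooth := ha.smooth.comp (contMDiff_fst.prodMk hb.smooth)
  velocity :=
    let ⟨_, hA⟩ := ha.velocity
    let ⟨_, hB⟩ := hb.velocity
    ⟨_, hA.mul hB ha hb⟩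

end Loops

section SkewProducts

variable {n : ℕ} {Y : Type*} [TopologicalSpace Y] [ChartedSpace (EuclideanSpace ℝ (Fin n)) Y]
  [IsManifold (𝓡 n) ∞ Y] {Ω : SymplecticForm n Y}

/-- The position of the base point of `S¹` after `k` steps of the sequential system, relative to
its initial position. -/
def totalRotation (α : ℕ → ℝ) (k : ℕ) : ℝ := ∑ i ∈ Finset.range k, α i

/-- The action on fibres of the evolution of the skew products, as a loop in `G`: it is
`t ↦ g_k h(t + β_(k-1)) ⋯ g_1 h(t)`, where `β` is the total rotation. -/
noncomputable def fibreLoop (α : ℕ → ℝ) (g : ℕ → HamDiffeo Ω) (h : UnitAddCircle → HamDiffeo Ω) :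
    ℕ → UnitAddCircle → HamDiffeo Ω
  | 0 => fun _ => 1
  | k + 1 => fun t => g k * (h (t + (totalRotation α k : UnitAddCircle)) * fibreLoop α g h k t)

theorem evolution_skewProduct (α : ℕ → ℝ) (g : ℕ → HamDiffeo Ω) (h : UnitAddCircle → HamDiffeo Ω)
    (k : ℕ) (t : UnitAddCircle) (y : Y) :
    evolution (fun i => skewProduct (α i) (g i) fun t => h t) k (t, y) =
      (t + (totalRotation α k : UnitAddCircle), fibreLoop α g h k t y) := by
  induction k with
  | zero => simp [evolution, totalRotation, fibreLoop]; rfl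
  | succ k ih =>
    have hs : totalRotation α (k + 1) = totalRotation α k + α k := Finset.sum_range_succ _ _
    rw [evolution, Function.comp_apply, ih, hs, AddCircle.coe_add, ← add_assoc]
    rfl

/-- Neither the factors `g_i` nor the rotations change the free homotopy class: `G` is connected by
paths, and a rotation of the circle is homotopic to the identity. -/
theorem represents_fibreLoop (α : ℕ → ℝ) (g : ℕ → HamDiffeo Ω) {h : UnitAddCircle → HamDiffeo Ω}
    {γ : FundamentalGroup (HamDiffeo Ω) (HamDiffeo.id Ω)} (hγ : Represents h γ) (k : ℕ) :
    Represents (fibreLoop α g h k) (γ ^ k) := by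
  induction k with
  | zero => exact Represents.const 1
  | succ k ih =>
    have := (Represents.const (g k)).mul ((hγ.rotate (totalRotation α k)).mul ih)
    rwa [one_mul, ← pow_succ'] at this

theorem isSmoothLoop_fibreLoop [CompactSpace Y] [MeasurableSpace Y] [BorelSpace Y] (α : ℕ → ℝ)
    (g : ℕ → HamDiffeo Ω) {h : UnitAddCircle → HamDiffeo Ω} (hh : IsSmoothLoop h) (k : ℕ) :
    IsSmoothLoop (fibreLoop α g h k) := by
  induction k with
  | zero => exact .const 1
  | succ k ih => exact (IsSmoothLoop.const (g k)).mul ((hh.rotate _).mul ih)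

/-- The Hamiltonian of the fibre loop, followed along the loop, is a Birkhoff sum of the function
`(t, y) ↦ H (t, h t y)` along the evolution of the skew products. -/
theorem exists_normalizedHamiltonian_fibreLoop [CompactSpace Y] [MeasurableSpace Y] [BorelSpace Y]
    (α : ℕ → ℝ) (g : ℕ → HamDiffeo Ω) {h : UnitAddCircle → HamDiffeo Ω} (hh : IsSmoothLoop h)
    {H : UnitAddCircle → Y → ℝ} (hH : IsNormalizedHamiltonian h H) (k : ℕ) :
    ∃ F, IsNormalizedHamiltonian (fibreLoop α g h k) F ∧ ∀ t y, F t (fibreLoop α g h k t y) =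
      ∑ i ∈ Finset.range k, (fun x : UnitAddCircle × Y => H x.1 (h x.1 x.2))
        (evolution (fun i => skewProduct (α i) (g i) fun t => h t) i (t, y)) := by
  induction k with
  | zero => exact ⟨_, .const 1, fun t y => by simp⟩
  | succ k ih =>
    obtain ⟨F, hF, hsum⟩ := ih
    have hs := isSmoothLoop_fibreLoop α g hh k
    refine ⟨_, (IsNormalizedHamiltonian.const (g k)).mul
      ((hH.rotate hh (totalRotation α k)).mul hF (hh.rotate _) hs) (.const (g k))
      ((hh.rotate _).mul hs), fun t y => ?_⟩
    rw [Finset.sum_range_succ, ← hsum, evolution_skewProduct]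
    simp [fibreLoop, HamDiffeo.mul_apply, add_comm]

theorem integral_hamiltonian_along_loop [CompactSpace Y] [MeasurableSpace Y] [BorelSpace Y]
    {h : UnitAddCircle → HamDiffeo Ω} (hh : IsSmoothLoop h) {H : UnitAddCircle → Y → ℝ}
    (hH : IsNormalizedHamiltonian h H) :
    ∫ x : UnitAddCircle × Y, H x.1 (h x.1 x.2) ∂(volume.prod (liouville Ω)) = 0 := by
  have hi : Integrable (fun x : UnitAddCircle × Y => H x.1 (h x.1 x.2))
      (volume.prod (liouville Ω)) :=
    (continuous_hamiltonian_along_loop hh hH).integrable_of_hasCompactSupport (.of_compactSpace _)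
  rw [integral_prod _ hi]
  simp only [HamDiffeo.integral_comp, hH.normalized, integral_zero]

/-- A bound on the time averages bounds Hofer's norm of a power. -/
theorem hoferNorm_pow_le [CompactSpace Y] [MeasurableSpace Y] [BorelSpace Y]
    (α : ℕ → ℝ) (g : ℕ → HamDiffeo Ω) {h : UnitAddCircle → HamDiffeo Ω} (hh : IsSmoothLoop h)
    {γ : FundamentalGroup (HamDiffeo Ω) (HamDiffeo.id Ω)} (hγ : Represents h γ)
    {H : UnitAddCircle → Y → ℝ} (hH : IsNormalizedHamiltonian h H) (k : ℕ) {c : ℝ≥0∞}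
    (hc : ∀ x, ‖∑ i ∈ Finset.range k, (fun x : UnitAddCircle × Y => H x.1 (h x.1 x.2))
        (evolution (fun i => skewProduct (α i) (g i) fun t => h t) i x)‖ₑ ≤ c) :
    hoferNorm (γ ^ k) ≤ c := by
  obtain ⟨F, hF, hsum⟩ := exists_normalizedHamiltonian_fibreLoop α g hh hH k
  calc hoferNorm (γ ^ k) ≤ hoferLength F :=
        iInf_le_of_le _ (iInf_le_of_le F (iInf_le_of_le (isSmoothLoop_fibreLoop α g hh k)
          (iInf_le_of_le hF (iInf_le _ (represents_fibreLoop α g hγ k)))))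
    _ ≤ ∫⁻ _ : UnitAddCircle, c := by
        refine lintegral_mono fun t => iSup_le fun z => ?_
        -- the maximum over `Y` may be taken along the loop, where `F` is a Birkhoff sum
        obtain ⟨y, rfl⟩ := (fibreLoop α g h k t).1.surjective z
        exact (congrArg _ (hsum t y)).trans_le (hc (t, y))
    _ = c := by simp

end SkewProducts

theorem mainTheorem8 {n : ℕ} {Y : Type*} [TopologicalSpace Y] [T2Space Y] [CompactSpace Y]
    [ConnectedSpace Y] [ChartedSpace (EuclideanSpace ℝ (Fin n)) Y] [IsManifold (𝓡 n) ∞ Y]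
    [MeasurableSpace Y] [BorelSpace Y] (Ω : SymplecticForm n Y)
    (α : ℕ → ℝ) (g : ℕ → HamDiffeo Ω)
    (h : UnitAddCircle → HamDiffeo Ω) (hh : IsSmoothLoop h)
    (γ : FundamentalGroup (HamDiffeo Ω) (HamDiffeo.id Ω)) (hγ : Represents h γ)
    (hT : StrictlyErgodicSeq ((volume : Measure UnitAddCircle).prod (liouville Ω))
      fun i => skewProduct (α i) (g i) fun t => h t) :
    HasAsymptoticHoferNorm γ 0 := by
  obtain ⟨H, hH⟩ := hh.velocity
  have herg := hT ⟨_, continuous_hamiltonian_along_loop hh hH⟩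
    (integral_hamiltonian_along_loop hh hH)
  rw [Metric.tendstoUniformly_iff] at herg
  refine ENNReal.tendsto_nhds_zero.2 fun ε hε => ?_
  obtain ⟨δ, hδ, hδε⟩ := ENNReal.lt_iff_exists_nnreal_btwn.1 hε
  filter_upwards [herg δ (by exact_mod_cast hδ), eventually_gt_atTop 0] with k hk hk0
  refine le_trans ?_ hδε.le
  have hk0' : (0 : ℝ) < k := by exact_mod_cast hk0
  refine ENNReal.div_le_of_le_mul (hoferNorm_pow_le α g hh hγ hH k fun x => ?_)
  have h1 := hk x
  rw [dist_zero_left, norm_mul, Real.norm_of_nonneg (by positivity), one_div,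
    inv_mul_lt_iff₀ hk0', mul_comm] at h1
  rw [← ofReal_norm, ← ENNReal.ofReal_coe_nnreal, ← ENNReal.ofReal_natCast,
    ← ENNReal.ofReal_mul (by positivity)]
  exact ENNReal.ofReal_le_ofReal h1.le
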